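/- Let $F$ be a field and let $n \ge 1$. Let $X$ be a regular $n$-dimensional cell complex, that is, a compact CW complex all of whose attaching maps are embeddings and in which the union of the $n$-cells is open and dense. Let $X_n$ be the (finite) set of $n$-cells of $X$, and let $M_n(X)$ be the linear matroid of the cellular boundary operator $\partial_n$ of $X$ with coefficients in $F$: its ground set is $X_n$, and a set of $n$-cells is independent if and only if the corresponding columns of $\partial_n$ are linearly independent. For a matroid $M$ with ground set $E$ and rank function $r$, an $l$-separation is a partition of $E$ into disjoint subsets $E_1, E_2$ with $|E_1|, |E_2| \ge l$ and $r(E_1) + r(E_2) \le r(M) + l - 1$; and $M$ is $k$-connected if it has no $l$-separation for $1 \le l < k$. For $E \subseteq X_n$ let $\overline{E}$ be the closure in $X$ of the union of the cells in $E$ (a subcomplex of $X$). For $E_1, E_2 \subseteq X_n$ let $\eta_{n-1}(E_1,E_2)$ be the nullity (the dimension of the kernel) of the map $$\tilde H_{n-1}(\overline{E_1} \cap \overline{E_2}; F) \to \tilde H_{n-1}(\overline{E_1}; F) \oplus \tilde H_{n-1}(\overline{E_2}; F)$$ induced by the inclusions on reduced cellular homology. Then for every integer $k \ge 0$, the matroid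 $M_n(X)$ is $k$-connected if and only if $\eta_{n-1}(E_1, E_2) \ge l$ for every integer $l$ with $1 \le l < k$ and every partition $X_n = E_1 \cup E_2$ into disjoint subsets with $|E_1|, |E_2| \ge l$. -/

import Mathlib

universe u

noncomputable section

namespace CellularMatroid

open CategoryTheory AlgebraicTopology Topology Set

/-! ### Matroids: linear matroids and Tutte connectivity -/

section Matroids

/-- The linear matroid of a family of vectors `w : α → V`: its ground set is all of `α`, and a set
of indices is independent iff the corresponding subfamily of vectors is linearly independent. -/
def linearMatroid {α : Type*} (F : Type*) {V : Type*} [Field F] [AddCommGroup V] [Module F V]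
    (w : α → V) : Matroid α :=
  (IndepMatroid.ofFinitary Set.univ (fun S ↦ LinearIndepOn F w S)
    (linearIndepOn_empty F w)
    (fun _ _ hJ hIJ ↦ hJ.mono hIJ)
    (by
      intro I B hI hImax hBmax
      by_contra! hcon
      have hB : ∀ x ∈ B, w x ∈ Submodule.span F (w '' I) := by
        intro x hx
        by_contra hxs
        have hxI : x ∉ I := fun h ↦ hxs (Submodule.subset_span ⟨x, h, rfl⟩)
        exact hcon x ⟨hx, hxI⟩ (hI.insert hxs)
      have hall : ∀ x, w x ∈ Submodule.span F (w '' B) := by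
        intro x
        by_contra hxs
        have hxB : x ∉ B := fun h ↦ hxs (Submodule.subset_span ⟨x, h, rfl⟩)
        exact hxB (hBmax.2 (hBmax.1.insert hxs) (subset_insert x B) (mem_insert x B))
      have hBI : Submodule.span F (w '' B) ≤ Submodule.span F (w '' I) := by
        rw [Submodule.span_le]
        rintro _ ⟨x, hx, rfl⟩
        exact hB x hx
      refine hImax ⟨hI, fun J hJ hIJ x hx ↦ ?_⟩
      by_contra hxI
      have h1 : LinearIndepOn F w (insert x I) := hJ.mono (insert_subset hx hIJ)
      exact ((linearIndepOn_insert hxI).1 h1).2 (hBI (hall x)))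
    (fun S hS ↦ linearIndepOn_of_finite S fun T hTS hT ↦ hS T hTS hT)
    (fun _ _ ↦ subset_univ _)).matroid

/-- `(E₁, E₂)` is a `k`-separation of `M` (for `k ≥ 1`): a partition of the ground set into
disjoint sets with `|E₁|, |E₂| ≥ k` and `r(E₁) + r(E₂) ≤ r(M) + k - 1`. -/
structure IsSeparation {α : Type*} (M : Matroid α) (k : ℕ) (E₁ E₂ : Set α) : Prop where
  union_eq : E₁ ∪ E₂ = M.E
  disjoint : Disjoint E₁ E₂
  le_left : (k : ℕ∞) ≤ E₁.encard
  le_right : (k : ℕ∞) ≤ E₂.encard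
  rank_le : M.eRk E₁ + M.eRk E₂ + 1 ≤ M.eRank + k

/-- `M` is `k`-connected if it has no `l`-separation for `1 ≤ l < k`. -/
def IsKConnected {α : Type*} (M : Matroid α) (k : ℕ) : Prop :=
  ∀ l : ℕ, 1 ≤ l → l < k → ∀ E₁ E₂ : Set α, ¬ IsSeparation M l E₁ E₂

end Matroids

/-! ### Subquotients -/

section Subquotients

variable {F : Type*} {V : Type*} [Field F] [AddCommGroup V] [Module F V]

/-- For subspaces `Z` and `B` of `V`, the quotient of `Z` by `Z ∩ B`; this is `Z / B` if `B ≤ Z`. -/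
def Subquotient (Z B : Submodule F V) : Type _ := Z ⧸ B.comap Z.subtype

instance (Z B : Submodule F V) : AddCommGroup (Subquotient Z B) :=
  inferInstanceAs (AddCommGroup (Z ⧸ B.comap Z.subtype))

instance (Z B : Submodule F V) : Module F (Subquotient Z B) :=
  inferInstanceAs (Module F (Z ⧸ B.comap Z.subtype))

/-- The map `Z / B → Z' / B'`, `[z] ↦ [z]`, for `Z ≤ Z'` and `B ≤ B'`. -/
def Subquotient.map {Z B Z' B' : Submodule F V} (hZ : Z ≤ Z') (hB : B ≤ B') :
    Subquotient Z B →ₗ[F] Subquotient Z' B' :=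
  Submodule.mapQ (B.comap Z.subtype) (B'.comap Z'.subtype) (Submodule.inclusion hZ)
    (fun _ hz ↦ hB hz)

end Subquotients

/-! ### Relative singular homology of pairs of subspaces -/

section Singular

variable (F : Type u) [Field F] {X : Type u} [TopologicalSpace X]

/-- The coefficient field `F`, as an object of the category of `F`-modules. -/
abbrev coeff : ModuleCat.{u} F := ModuleCat.of F F

/-- The inclusion of subspaces `A ⊆ B` of `X`. -/
def incl {A B : Set X} (h : A ⊆ B) : TopCat.of A ⟶ TopCat.of B :=
  TopCat.ofHom ⟨Set.inclusion h, continuous_inclusion h⟩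

lemma incl_comp {A B D : Set X} (h : A ⊆ B) (h' : B ⊆ D) :
    incl h ≫ incl h' = incl (h.trans h') := rfl

instance {A B : Set X} (h : A ⊆ B) : Mono (incl h) :=
  (TopCat.mono_iff_injective _).2 (Set.inclusion_injective h)

/-- The singular chain complex of the subspace `A` with coefficients in `F`. -/
abbrev chains (A : Set X) : ChainComplex (ModuleCat.{u} F) ℕ :=
  ((singularChainComplexFunctor (ModuleCat.{u} F)).obj (coeff F)).obj (TopCat.of A)

/-- The map of singular chain complexes induced by an inclusion `A ⊆ B`. -/
abbrev chainsMap {A B : Set X} (h : A ⊆ B) : chains F A ⟶ chains F B :=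
  ((singularChainComplexFunctor (ModuleCat.{u} F)).obj (coeff F)).map (incl h)

lemma chainsMap_comp {A B D : Set X} (h : A ⊆ B) (h' : B ⊆ D) :
    chainsMap F h ≫ chainsMap F h' = chainsMap F (h.trans h') := by
  rw [← Functor.map_comp, incl_comp]

/-- The relative singular chain complex `S(B) / S(A)` of a pair `A ⊆ B` of subspaces of `X`. -/
def relChains {A B : Set X} (h : A ⊆ B) : ChainComplex (ModuleCat.{u} F) ℕ :=
  Limits.cokernel (chainsMap F h)

/-- The projection `S(B) ⟶ S(B) / S(A)`. -/
def relProj {A B : Set X} (h : A ⊆ B) : chains F B ⟶ relChains F h :=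
  Limits.cokernel.π (chainsMap F h)

/-- The map `S(B) / S(A) ⟶ S(B') / S(A')` induced by an inclusion of pairs. -/
def relChainsMap {A B A' B' : Set X} (h : A ⊆ B) (h' : A' ⊆ B') (hA : A ⊆ A') (hB : B ⊆ B') :
    relChains F h ⟶ relChains F h' :=
  Limits.cokernel.map _ _ (chainsMap F hA) (chainsMap F hB)
    (by rw [chainsMap_comp, chainsMap_comp])

/-- The relative singular homology group `H_k(B, A; F)`. -/
abbrev relHomology (k : ℕ) {A B : Set X} (h : A ⊆ B) : ModuleCat.{u} F :=
  (relChains F h).homology k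

/-- The map `H_k(B, A; F) → H_k(B', A'; F)` induced by an inclusion of pairs. -/
def relHomologyMap (k : ℕ) {A B A' B' : Set X} (h : A ⊆ B) (h' : A' ⊆ B') (hA : A ⊆ A')
    (hB : B ⊆ B') : relHomology F k h →ₗ[F] relHomology F k h' :=
  (HomologicalComplex.homologyMap (relChainsMap F h h' hA hB) k).hom

/-- The short sequence `S(A) ⟶ S(B) ⟶ S(B) / S(A)`. -/
def pairSequence {A B : Set X} (h : A ⊆ B) :
    ShortComplex (ChainComplex (ModuleCat.{u} F) ℕ) :=
  ShortComplex.mk (chainsMap F h) (relProj F h) (Limits.cokernel.condition _)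

lemma pairSequence_shortExact {A B : Set X} (h : A ⊆ B) : (pairSequence F h).ShortExact where
  exact := ShortComplex.exact_cokernel _
  mono_f := inferInstanceAs (Mono (chainsMap F h))
  epi_g := inferInstanceAs (Epi (Limits.cokernel.π (chainsMap F h)))

/-- The boundary map of a triple `A ⊆ B ⊆ D`: the composite
`H_{k+1}(D, B; F) → H_k(B; F) → H_k(B, A; F)` of the connecting homomorphism of the pair `(D, B)`
and the map induced by `(B, ∅) → (B, A)`. -/
def tripleBoundary (k : ℕ) {A B D : Set X} (h : A ⊆ B) (h' : B ⊆ D) :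
    relHomology F (k + 1) h' →ₗ[F] relHomology F k h :=
  ((pairSequence_shortExact F h').δ (k + 1) k rfl ≫
    HomologicalComplex.homologyMap (relProj F h) k).hom

/-- The augmentation `H_0(A; F) → F` on singular homology of a subspace `A`; it sends the class of
every point to `1`. -/
def singularAugmentation (A : Set X) : (chains F A).homology 0 →ₗ[F] F :=
  ((TopCat.of A).singularHomology₀ε (coeff F)).hom

end Singular

/-! ### The cellular chain complex and the cellular matroids -/

section Cellular

open Topology.CWComplex Metric

variable {X : Type u} [TopologicalSpace X] [T2Space X] (C : Set X) [CWComplex C]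

/-- `skel C k` is the `(k-1)`-skeleton, i.e. the union of all cells of dimension `< k`. -/
def skel (k : ℕ) : Set X := skeletonLT C (k : ℕ∞)

lemma skel_mono (k : ℕ) : skel C k ⊆ skel C (k + 1) :=
  CWComplex.skeletonLT_mono (by exact_mod_cast Nat.le_succ k)

variable {C}

lemma closedCell_subset_skel (k : ℕ) (b : cell C k) : closedCell k b ⊆ skel C (k + 1) := by
  have := CWComplex.closedCell_subset_skeletonLT k b
  simpa [skel] using this

lemma cellFrontier_subset_skel (k : ℕ) (b : cell C k) : cellFrontier k b ⊆ skel C k :=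
  CWComplex.cellFrontier_subset_skeletonLT k b

lemma skel_disjoint_openCell (k : ℕ) (b : cell C k) : Disjoint (skel C k) (openCell k b) :=
  CWComplex.disjoint_skeletonLT_openCell le_rfl

lemma cellFrontier_subset_skel_diff (k : ℕ) (b : cell C k) {y : X} (hy : y ∈ openCell k b) :
    cellFrontier k b ⊆ skel C (k + 1) \ {y} := by
  intro x hx
  refine ⟨skel_mono C k (cellFrontier_subset_skel k b hx), ?_⟩
  rintro rfl
  exact (Set.disjoint_left.1 (skel_disjoint_openCell k b)) (cellFrontier_subset_skel k b hx) hy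

variable (F : Type u) [Field F]

/-- A class `g ∈ H_k(ē, ∂e; F)`, where `ē` is the closed `k`-cell `b` and `∂e` its frontier, is
locally nonzero if it restricts to a nonzero element (equivalently, a generator) of the
one-dimensional local homology group `H_k(X^k, X^k ∖ {y}; F)` of the `k`-skeleton at every point `y`
of the open cell. -/
def IsLocallyNonzero (k : ℕ) (b : cell C k)
    (g : relHomology F k (cellFrontier_subset_closedCell k b)) : Prop :=
  ∀ (y : X) (hy : y ∈ openCell k b),
    relHomologyMap F k (cellFrontier_subset_closedCell k b)
      (sdiff_subset : skel C (k + 1) \ {y} ⊆ skel C (k + 1))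
      (cellFrontier_subset_skel_diff k b hy) (closedCell_subset_skel k b) g ≠ 0

/-- An orientation (fundamental class) over `F` of the `k`-cell `b` of a regular complex: a locally
nonzero class in `H_k(ē, ∂e; F)`. For `k ≥ 1` these are exactly the generators of that
one-dimensional space. A point (`k = 0`) carries its canonical orientation: the class of
augmentation `1`. -/
def IsOrientation : (k : ℕ) → (b : cell C k) →
    relHomology F k (cellFrontier_subset_closedCell k b) → Prop
  | 0, b, g => IsLocallyNonzero F 0 b g ∧ ∃ z : (chains F (closedCell 0 b)).homology 0,
      (HomologicalComplex.homologyMap (relProj F (cellFrontier_subset_closedCell 0 b)) 0).hom z = g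
        ∧ singularAugmentation F (closedCell 0 b) z = 1
  | k + 1, b, g => IsLocallyNonzero F (k + 1) b g

open Classical in
/-- A chosen orientation of each cell. (Every cell of a regular complex has one, unique up to a
nonzero scalar; the value `0` is only a default that makes the definition total.) -/
def orientation (k : ℕ) (b : cell C k) : relHomology F k (cellFrontier_subset_closedCell k b) :=
  if h : ∃ g, IsOrientation F k b g then h.choose else 0

variable (C)

/-- The group of cellular `k`-chains `H_k(X^k, X^{k-1}; F)`. -/
abbrev cellularGroup (k : ℕ) : ModuleCat.{u} F := relHomology F k (skel_mono C k)

/-- The boundary operator `H_{k+1}(X^{k+1}, X^k; F) → H_k(X^k, X^{k-1}; F)` of the cellular chain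
complex. -/
def cellularGroupBoundary (k : ℕ) : cellularGroup C F (k + 1) →ₗ[F] cellularGroup C F k :=
  tripleBoundary F k (skel_mono C k) (skel_mono C (k + 1))

variable {C}

/-- The class of the (oriented) `k`-cell `b` in `H_k(X^k, X^{k-1}; F)`. -/
def cellClass (k : ℕ) (b : cell C k) : cellularGroup C F k :=
  relHomologyMap F k (cellFrontier_subset_closedCell k b) (skel_mono C k)
    (cellFrontier_subset_skel k b) (closedCell_subset_skel k b) (orientation F k b)

variable (C)

open Classical in
/-- The coordinates on `H_k(X^k, X^{k-1}; F)` with respect to its basis of cell classes. (The cell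
classes do form a basis; the value `0` is only a default that makes the definition total.) -/
def cellCoord (k : ℕ) : cellularGroup C F k →ₗ[F] (cell C k →₀ F) :=
  if h : LinearIndependent F (cellClass F (C := C) k) ∧
      ⊤ ≤ Submodule.span F (Set.range (cellClass F (C := C) k)) then
    (Module.Basis.mk h.1 h.2).repr.toLinearMap
  else 0

/-- The cellular boundary operator `∂_{k+1} : F^{(X_{k+1})} → F^{(X_k)}`, i.e. the boundary operator
`H_{k+1}(X^{k+1}, X^k; F) → H_k(X^k, X^{k-1}; F)` written in terms of cells. -/
def cellBoundary (k : ℕ) : (cell C (k + 1) →₀ F) →ₗ[F] (cell C k →₀ F) :=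
  cellCoord C F k ∘ₗ cellularGroupBoundary C F k ∘ₗ
    Finsupp.linearCombination F (cellClass F (C := C) (k + 1))

/-- The cellular matroid `M_{k+1}(X)` in degree `k + 1`: the linear matroid on (the columns of)
`∂_{k+1}`, with ground set the set of `(k+1)`-cells. -/
def cellularMatroid (k : ℕ) : Matroid (cell C (k + 1)) :=
  linearMatroid F fun a : cell C (k + 1) ↦ cellBoundary C F k (Finsupp.single a 1)

/-! ### Reduced cellular homology of subcomplexes -/

/-- The `k`-cells of `X` lying in `Y ⊆ X`. -/
def cellsIn (Y : Set X) (k : ℕ) : Set (cell C k) := {b | openCell k b ⊆ Y}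

/-- The cellular `k`-chains of a subcomplex `Y`: chains of `X` supported on the cells of `Y`. -/
def chainsIn (Y : Set X) (k : ℕ) : Submodule F (cell C k →₀ F) :=
  Finsupp.supported F F (cellsIn C Y k)

/-- The augmentation `F^{(X_0)} → F`, the sum of the coefficients. -/
def augmentation : (cell C 0 →₀ F) →ₗ[F] F :=
  Finsupp.linearCombination F fun _ ↦ (1 : F)

/-- The reduced cellular `k`-cycles of a subcomplex `Y`: the kernel of `∂_k` on the chains of `Y`,
where `∂_0` is the augmentation. -/
def reducedCycles (Y : Set X) : (k : ℕ) → Submodule F (cell C k →₀ F)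
  | 0 => chainsIn C F Y 0 ⊓ LinearMap.ker (augmentation C F)
  | k + 1 => chainsIn C F Y (k + 1) ⊓ LinearMap.ker (cellBoundary C F k)

/-- The cellular `k`-boundaries of a subcomplex `Y`. -/
def boundaries (Y : Set X) (k : ℕ) : Submodule F (cell C k →₀ F) :=
  (chainsIn C F Y (k + 1)).map (cellBoundary C F k)

/-- The reduced cellular homology `H̃_k(Y; F)` of a subcomplex `Y` of `X`: reduced cycles modulo
boundaries. -/
abbrev ReducedHomology (Y : Set X) (k : ℕ) : Type u :=
  Subquotient (reducedCycles C F Y k) (boundaries C F Y k)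

variable {C}

lemma chainsIn_mono {Y Z : Set X} (h : Y ⊆ Z) (k : ℕ) : chainsIn C F Y k ≤ chainsIn C F Z k :=
  Finsupp.supported_mono fun _ hb ↦ Set.Subset.trans hb h

lemma reducedCycles_mono {Y Z : Set X} (h : Y ⊆ Z) :
    ∀ k, reducedCycles C F Y k ≤ reducedCycles C F Z k
  | 0 => inf_le_inf_right _ (chainsIn_mono F h 0)
  | k + 1 => inf_le_inf_right _ (chainsIn_mono F h (k + 1))

lemma boundaries_mono {Y Z : Set X} (h : Y ⊆ Z) (k : ℕ) :
    boundaries C F Y k ≤ boundaries C F Z k :=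
  Submodule.map_mono (chainsIn_mono F h (k + 1))

variable (C)

/-- The map `H̃_k(Y; F) → H̃_k(Z; F)` induced by the inclusion of subcomplexes `Y ⊆ Z`. -/
def reducedHomologyMap {Y Z : Set X} (h : Y ⊆ Z) (k : ℕ) :
    ReducedHomology C F Y k →ₗ[F] ReducedHomology C F Z k :=
  Subquotient.map (reducedCycles_mono F h k) (boundaries_mono F h k)

/-- The closure `Ē` in `X` of the union of a set `E` of `n`-cells. -/
def cellClosure {n : ℕ} (E : Set (cell C n)) : Set X := closure (⋃ a ∈ E, openCell n a)

/-- The nullity `η_k(E₁, E₂)` of the map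
`H̃_k(Ē₁ ∩ Ē₂; F) → H̃_k(Ē₁; F) ⊕ H̃_k(Ē₂; F)` induced by the inclusions. -/
def eta {n : ℕ} (k : ℕ) (E₁ E₂ : Set (cell C n)) : ℕ :=
  Module.finrank F (LinearMap.ker
    ((reducedHomologyMap C F (inter_subset_left : cellClosure C E₁ ∩ cellClosure C E₂ ⊆ _) k).prod
      (reducedHomologyMap C F (inter_subset_right : cellClosure C E₁ ∩ cellClosure C E₂ ⊆ _) k)))

/-! ### Regular and `n`-dimensional complexes -/

/-- A CW complex is regular if it is compact and all its attaching maps are embeddings. -/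
structure IsRegular : Prop where
  isCompact : IsCompact C
  isEmbedding : ∀ (k : ℕ) (b : cell C k),
    IsEmbedding ((sphere (0 : Fin k → ℝ) 1).domRestrict (map (C := C) k b))

/-- A CW complex is `n`-dimensional if the union of its `n`-cells is an open dense subset of it. -/
structure IsPureDimensional (n : ℕ) : Prop where
  isOpen : IsOpen ((↑) ⁻¹' (⋃ a : cell C n, openCell n a) : Set C)
  dense : Dense ((↑) ⁻¹' (⋃ a : cell C n, openCell n a) : Set C)

end Cellular

end CellularMatroid

end

/-! For a set `E` of top cells let `B(E)` be the span of the corresponding columns of the boundary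
operator; these are the boundaries of the closure of `E`, and their dimension is the rank of `E`.
For a partition, `B(E₁) + B(E₂)` is the full column space, so `r(E₁) + r(E₂) - r(M) = dim (B(E₁) ∩
B(E₂))`. It remains to identify this with `η`, which is `eta_eq_finrank_inf`. The intersection of
the two closures contains no top cell, so its homology is its space of reduced cycles, and the
kernel in question consists of the cycles lying in both `B(Eᵢ)`. Conversely, an element of both is
supported on both closures (`cellBoundary_single_apply_eq_zero`) and is a reduced cycle
(`cellBoundary_cellBoundary`, and `augmentation_cellBoundary` in degree 0). These facts about the
cellular boundary follow formally from singular homology. It need not be known that cell classes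
form a basis: where they do not, `cellCoord` is 0 and the claims are trivial. -/

section

open CategoryTheory Limits AlgebraicTopology

/-! ### Naturality of the augmentation -/

namespace SSet

universe w v u'

variable {D : Type u'} [Category.{v} D] [HasCoproducts.{w} D] [Preadditive D]
  [CategoryWithHomology D]

/-- The augmentation on the homology of simplicial sets in degree zero is natural. -/
lemma homologyMap_comp_homology₀ε {S T : SSet.{w}} (f : S ⟶ T) (R : D) :
    SSet.homologyMap f R 0 ≫ T.homology₀ε R = S.homology₀ε R := by
  -- Every 0-chain is a cycle, so maps out of degree-0 homology are determined by their values on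
  -- vertices.
  have hinv : (S.chainComplex R).liftCycles (𝟙 ((S.chainComplex R).X 0)) 0 (by simp) (by simp) ≫
      (S.chainComplex R).iCycles 0 = 𝟙 _ := by simp
  have : IsIso ((S.chainComplex R).liftCycles (𝟙 ((S.chainComplex R).X 0)) 0 (by simp)
      (by simp)) := by
    have h := IsIso.of_isIso_fac_right hinv
    exact h
  rw [← cancel_epi ((S.chainComplex R).homologyπ 0),
    ← cancel_epi ((S.chainComplex R).liftCycles (𝟙 ((S.chainComplex R).X 0)) 0 (by simp)
      (by simp))]
  refine SSet.chainComplex_hom_ext fun x ↦ ?_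
  rw [HomologicalComplex.homologyπ_naturality_assoc,
    HomologicalComplex.liftCycles_comp_cyclesMap_assoc,
    HomologicalComplex.comp_liftCycles_assoc, HomologicalComplex.comp_liftCycles_assoc]
  simp only [Category.id_comp, Category.comp_id, SSet.ι_chainComplexMap_f,
    SSet.liftCycles_ιChainComplex_homologyπ_homology₀ε]

end SSet

end

namespace CellularMatroid

open CategoryTheory AlgebraicTopology Topology Set

/-! ### Rank in linear matroids -/

section Matroids

variable {α F V : Type*} [Field F] [AddCommGroup V] [Module F V]

lemma linearMatroid_indep {w : α → V} {S : Set α} :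
    (linearMatroid F w).Indep S ↔ LinearIndepOn F w S := by
  simp [linearMatroid]

lemma linearMatroid_ground (w : α → V) : (linearMatroid F w).E = univ := rfl

/-- The rank in a linear matroid is the dimension of the linear span. -/
lemma linearMatroid_eRk [Finite α] (w : α → V) (S : Set α) :
    (linearMatroid F w).eRk S = (Module.finrank F (Submodule.span F (w '' S)) : ℕ∞) := by
  obtain ⟨I, hI⟩ := (linearMatroid F w).exists_isBasis S (subset_univ S)
  have hind := linearMatroid_indep.1 hI.indep
  have hspan : Submodule.span F (w '' S) = Submodule.span F (w '' I) := by
    refine le_antisymm (Submodule.span_le.2 ?_) (Submodule.span_mono (image_mono hI.subset))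
    rintro _ ⟨x, hx, rfl⟩
    by_contra hxs
    have hxI : x ∉ I := fun h ↦ hxs (Submodule.subset_span ⟨x, h, rfl⟩)
    exact hxI (hI.mem_of_insert_indep hx (linearMatroid_indep.2 (hind.insert hxs)))
  have := Fintype.ofFinite I
  rw [hI.eRk_eq_encard, hspan, image_eq_range, finrank_span_eq_card hind,
    ← coe_fintypeCard]

end Matroids

/-! ### Kernels of maps between subquotients -/

section Subquotients

variable {F V : Type*} [Field F] [AddCommGroup V] [Module F V]

/-- For cycles `Z` without boundaries, the classes that become boundaries in both `Z₁ / B₁` and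
`Z₂ / B₂` are the elements of `B₁ ⊓ B₂`. -/
lemma Subquotient.finrank_ker_map_prod_map {Z B Z₁ B₁ Z₂ B₂ : Submodule F V}
    (hZ₁ : Z ≤ Z₁) (hB₁ : B ≤ B₁) (hZ₂ : Z ≤ Z₂) (hB₂ : B ≤ B₂) (hB : B = ⊥)
    (hZ : B₁ ⊓ B₂ ≤ Z) :
    Module.finrank F (LinearMap.ker ((map hZ₁ hB₁).prod (map hZ₂ hB₂))) =
      Module.finrank F (B₁ ⊓ B₂ : Submodule F V) := by
  subst hB
  -- Nothing is divided out of `Z`, so this map is injective; its image will be the kernel.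
  let f : (B₁ ⊓ B₂ : Submodule F V) →ₗ[F] Subquotient Z ⊥ :=
    (Submodule.mkQ ((⊥ : Submodule F V).comap Z.subtype)) ∘ₗ Submodule.inclusion hZ
  have hf : Function.Injective f := by
    rw [← LinearMap.ker_eq_bot, LinearMap.ker_eq_bot']
    intro x hx
    have := (Submodule.Quotient.mk_eq_zero _).1 hx
    exact Subtype.ext ((Submodule.mem_bot F).1 this)
  suffices h : LinearMap.ker ((map hZ₁ hB₁).prod (map hZ₂ hB₂)) = LinearMap.range f by
    rw [h, LinearMap.finrank_range_of_inj hf]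
  ext x
  obtain ⟨z, rfl⟩ := Submodule.mkQ_surjective ((⊥ : Submodule F V).comap Z.subtype) x
  have h₁ : map hZ₁ hB₁ (Submodule.mkQ ((⊥ : Submodule F V).comap Z.subtype) z) = 0 ↔
      (z : V) ∈ B₁ := Submodule.Quotient.mk_eq_zero _
  have h₂ : map hZ₂ hB₂ (Submodule.mkQ ((⊥ : Submodule F V).comap Z.subtype) z) = 0 ↔
      (z : V) ∈ B₂ := Submodule.Quotient.mk_eq_zero _
  refine (Prod.mk_eq_zero.trans (and_congr h₁ h₂)).trans ?_
  constructor
  · rintro ⟨h, h'⟩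
    exact ⟨⟨z, h, h'⟩, rfl⟩
  · rintro ⟨y, hy⟩
    have := (Submodule.Quotient.eq _).1 hy
    have hyz : (y : V) = z := sub_eq_zero.1 ((Submodule.mem_bot F).1 this)
    exact hyz ▸ y.2

end Subquotients

/-! ### Formal properties of relative singular homology -/

section Singular

variable (F : Type u) [Field F] {X : Type u} [TopologicalSpace X]

lemma relProj_relChainsMap {A B A' B' : Set X} (h : A ⊆ B) (h' : A' ⊆ B') (hA : A ⊆ A')
    (hB : B ⊆ B') :
    relProj F h ≫ relChainsMap F h h' hA hB = chainsMap F hB ≫ relProj F h' :=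
  Limits.cokernel.π_desc _ _ _

lemma chainsMap_relProj {A B : Set X} (h : A ⊆ B) : chainsMap F h ≫ relProj F h = 0 :=
  Limits.cokernel.condition _

instance {A B : Set X} (h : A ⊆ B) : Epi (relProj F h) :=
  inferInstanceAs (Epi (Limits.cokernel.π (chainsMap F h)))

lemma relChainsMap_comp {A B A' B' A'' B'' : Set X} (h : A ⊆ B) (h' : A' ⊆ B') (h'' : A'' ⊆ B'')
    (hA : A ⊆ A') (hB : B ⊆ B') (hA' : A' ⊆ A'') (hB' : B' ⊆ B'') :
    relChainsMap F h h' hA hB ≫ relChainsMap F h' h'' hA' hB' =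
      relChainsMap F h h'' (hA.trans hA') (hB.trans hB') := by
  rw [← cancel_epi (relProj F h), ← Category.assoc, relProj_relChainsMap, Category.assoc,
    relProj_relChainsMap, relProj_relChainsMap, ← Category.assoc, chainsMap_comp]

lemma relHomologyMap_relHomologyMap (k : ℕ) {A B A' B' A'' B'' : Set X} (h : A ⊆ B) (h' : A' ⊆ B')
    (h'' : A'' ⊆ B'') (hA : A ⊆ A') (hB : B ⊆ B') (hA' : A' ⊆ A'') (hB' : B' ⊆ B'')
    (x : relHomology F k h) :
    relHomologyMap F k h' h'' hA' hB' (relHomologyMap F k h h' hA hB x) =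
      relHomologyMap F k h h'' (hA.trans hA') (hB.trans hB') x := by
  rw [relHomologyMap, relHomologyMap, relHomologyMap, ← relChainsMap_comp F h h' h'' hA hB hA' hB',
    HomologicalComplex.homologyMap_comp, ModuleCat.hom_comp, LinearMap.comp_apply]

/-- A map of pairs `(B, A) → (B', A')` with `B ⊆ A'` is zero on homology. -/
lemma relHomologyMap_eq_zero (k : ℕ) {A B A' B' : Set X} (h : A ⊆ B) (h' : A' ⊆ B')
    (hA : A ⊆ A') (hB : B ⊆ B') (hBA : B ⊆ A') : relHomologyMap F k h h' hA hB = 0 := by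
  -- On chains, `S(B) ⟶ S(B') / S(A')` factors through `S(A')`, which the projection kills.
  have : relChainsMap F h h' hA hB = 0 := by
    rw [← cancel_epi (relProj F h), relProj_relChainsMap, ← chainsMap_comp F hBA h',
      Category.assoc, chainsMap_relProj, Limits.comp_zero, Limits.comp_zero]
  rw [relHomologyMap, this, HomologicalComplex.homologyMap_zero, ModuleCat.hom_zero]

noncomputable section

/-- The map of short exact sequences of chain complexes induced by a map of pairs. -/
def pairSequenceMap {A B A' B' : Set X} (h : A ⊆ B) (h' : A' ⊆ B') (hA : A ⊆ A') (hB : B ⊆ B') :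
    pairSequence F h ⟶ pairSequence F h' where
  τ₁ := chainsMap F hA
  τ₂ := chainsMap F hB
  τ₃ := relChainsMap F h h' hA hB
  comm₁₂ := by
    change chainsMap F hA ≫ chainsMap F h' = chainsMap F h ≫ chainsMap F hB
    rw [chainsMap_comp, chainsMap_comp]
  comm₂₃ := (relProj_relChainsMap F h h' hA hB).symm

/-- The connecting homomorphism `H_{k+1}(B, A; F) ⟶ H_k(A; F)`. -/
def connecting (k : ℕ) {A B : Set X} (h : A ⊆ B) :
    relHomology F (k + 1) h ⟶ (chains F A).homology k :=
  (pairSequence_shortExact F h).δ (k + 1) k rfl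

end

lemma connecting_comp_homologyMap (k : ℕ) {A B : Set X} (h : A ⊆ B) :
    connecting F k h ≫ HomologicalComplex.homologyMap (chainsMap F h) k = 0 :=
  (pairSequence_shortExact F h).δ_comp (k + 1) k rfl

lemma homologyMap_comp_connecting (k : ℕ) {A B : Set X} (h : A ⊆ B) :
    HomologicalComplex.homologyMap (relProj F h) (k + 1) ≫ connecting F k h = 0 :=
  (pairSequence_shortExact F h).comp_δ (k + 1) k rfl

lemma connecting_naturality (k : ℕ) {A B A' B' : Set X} (h : A ⊆ B) (h' : A' ⊆ B') (hA : A ⊆ A')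
    (hB : B ⊆ B') :
    connecting F k h ≫ HomologicalComplex.homologyMap (chainsMap F hA) k =
      HomologicalComplex.homologyMap (relChainsMap F h h' hA hB) (k + 1) ≫ connecting F k h' :=
  HomologicalComplex.HomologySequence.δ_naturality (pairSequenceMap F h h' hA hB)
    (pairSequence_shortExact F h) (pairSequence_shortExact F h') (k + 1) k rfl

/-- The boundary map of a triple is natural. -/
lemma relHomologyMap_tripleBoundary (k : ℕ) {A B D A' B' D' : Set X} (h : A ⊆ B) (h' : B ⊆ D)
    (g : A' ⊆ B') (g' : B' ⊆ D') (hA : A ⊆ A') (hB : B ⊆ B') (hD : D ⊆ D')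
    (x : relHomology F (k + 1) h') :
    relHomologyMap F k h g hA hB (tripleBoundary F k h h' x) =
      tripleBoundary F k g g' (relHomologyMap F (k + 1) h' g' hB hD x) := by
  have key : (connecting F k h' ≫ HomologicalComplex.homologyMap (relProj F h) k) ≫
        HomologicalComplex.homologyMap (relChainsMap F h g hA hB) k =
      HomologicalComplex.homologyMap (relChainsMap F h' g' hB hD) (k + 1) ≫
        connecting F k g' ≫ HomologicalComplex.homologyMap (relProj F g) k := by
    rw [Category.assoc, ← HomologicalComplex.homologyMap_comp, relProj_relChainsMap,
      HomologicalComplex.homologyMap_comp, ← Category.assoc, connecting_naturality,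
      Category.assoc]
  exact congrArg (fun f ↦ f.hom x) key

/-- The composite contains `H_{k+1}(D) → H_{k+1}(D, B) → H_k(B)`, two consecutive maps of the long
exact sequence of a pair. -/
lemma tripleBoundary_tripleBoundary (k : ℕ) {A B D E : Set X} (h : A ⊆ B) (h' : B ⊆ D)
    (h'' : D ⊆ E) (x : relHomology F (k + 2) h'') :
    tripleBoundary F k h h' (tripleBoundary F (k + 1) h' h'' x) = 0 := by
  have key : (connecting F (k + 1) h'' ≫ HomologicalComplex.homologyMap (relProj F h') (k + 1)) ≫
      connecting F k h' ≫ HomologicalComplex.homologyMap (relProj F h) k = 0 := by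
    rw [Category.assoc, ← Category.assoc (HomologicalComplex.homologyMap _ _),
      homologyMap_comp_connecting, Limits.zero_comp, Limits.comp_zero]
  exact congrArg (fun f ↦ f.hom x) key

lemma singularAugmentation_homologyMap {A B : Set X} (h : A ⊆ B)
    (z : (chains F A).homology 0) :
    singularAugmentation F B ((HomologicalComplex.homologyMap (chainsMap F h) 0).hom z) =
      singularAugmentation F A z :=
  congrArg (fun f ↦ f.hom z)
    (SSet.homologyMap_comp_homology₀ε (TopCat.toSSet.map (incl h)) (coeff F))

/-- Standard simplices are nonempty, so the empty space has no singular simplex. -/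
lemma chainsMap_eq_zero_of_eq_empty {A B : Set X} (h : A ⊆ B) (hA : A = ∅) :
    chainsMap F h = 0 := by
  subst hA
  ext n : 1
  refine SSet.chainComplex_hom_ext (X := TopCat.toSSet.obj (TopCat.of (∅ : Set X))) fun s ↦ ?_
  obtain ⟨p⟩ : Nonempty (SimplexCategory.toTop.{u}.obj (SimplexCategory.mk n)) := inferInstance
  exact (s.down.hom p).2.elim

/-- Relative to the empty set, the augmentation descends to relative homology. -/
lemma exists_augmentation_of_eq_empty {A B : Set X} (h : A ⊆ B) (hA : A = ∅) :
    ∃ ε : relHomology F 0 h →ₗ[F] F, ∀ z : (chains F B).homology 0,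
      ε ((HomologicalComplex.homologyMap (relProj F h) 0).hom z) = singularAugmentation F B z := by
  -- As `S(A) ⟶ S(B)` is zero, the identity of `S(B)` descends to the quotient and splits the
  -- projection.
  let r : relChains F h ⟶ chains F B := Limits.cokernel.desc (chainsMap F h) (𝟙 _)
    (by rw [chainsMap_eq_zero_of_eq_empty F h hA, Limits.zero_comp])
  have hr : relProj F h ≫ r = 𝟙 _ := Limits.cokernel.π_desc _ _ _
  refine ⟨singularAugmentation F B ∘ₗ (HomologicalComplex.homologyMap r 0).hom, fun z ↦ ?_⟩
  have key : HomologicalComplex.homologyMap (relProj F h) 0 ≫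
      HomologicalComplex.homologyMap r 0 = 𝟙 _ := by
    rw [← HomologicalComplex.homologyMap_comp, hr, HomologicalComplex.homologyMap_id]
  exact congrArg (fun f ↦ singularAugmentation F B (f.hom z)) key

end Singular

/-! ### Finiteness and closures of sets of cells -/

section Cellular

open Topology.CWComplex Metric

variable {X : Type u} [TopologicalSpace X] [T2Space X] (C : Set X) [CWComplex C]

/-- A compact CW complex has finitely many cells of each dimension. -/
lemma finite_cell_of_isCompact (hC : IsCompact C) (n : ℕ) : Finite (cell C n) := by
  -- Take the centres of the `n`-cells. Any set of centres meets each open cell in at most one point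
  -- and is therefore closed, so the set of all centres is compact and discrete.
  let p : cell C n → X := fun b ↦ map (C := C) n b 0
  have hp : ∀ b, p b ∈ openCell n b := fun b ↦ CWComplex.map_zero_mem_openCell n b
  have hinj : ∀ {b : cell C n} {m : ℕ} {j : cell C m}, p b ∈ openCell m j →
      (⟨n, b⟩ : Σ n, cell C n) = ⟨m, j⟩ := fun {b m j} hb ↦
    CWComplex.eq_of_not_disjoint_openCell (Set.not_disjoint_iff.2 ⟨p b, hp b, hb⟩)
  have hcl : ∀ A ⊆ range p, IsClosed A := by
    intro A hA
    have hAC : A ⊆ C := by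
      refine hA.trans ?_
      rintro _ ⟨b, rfl⟩
      exact CWComplex.openCell_subset_complex n b (hp b)
    refine CWComplex.isClosed_of_isClosed_inter_openCell_or_isClosed_inter_closedCell hAC
      fun m _ j ↦ Or.inl (Set.Subsingleton.isClosed ?_)
    rintro x ⟨hx, hxj⟩ y ⟨hy, hyj⟩
    obtain ⟨b, rfl⟩ := hA hx
    obtain ⟨c, rfl⟩ := hA hy
    have h := (hinj hxj).trans (hinj hyj).symm
    simp only [Sigma.mk.injEq, heq_eq_eq, true_and] at h
    rw [h]
  have hcomp : IsCompact (range p) := hC.of_isClosed_subset (hcl _ subset_rfl) (by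
    rintro _ ⟨b, rfl⟩
    exact CWComplex.openCell_subset_complex n b (hp b))
  have hdisc : IsDiscrete (range p) := by
    refine ⟨discreteTopology_iff_forall_isClosed.2 fun s ↦ ?_⟩
    rw [← Subtype.val_injective.preimage_image s]
    exact (hcl _ (Subtype.coe_image_subset _ s)).preimage continuous_subtype_val
  have hfin : (range p).Finite := hcomp.finite hdisc
  have hpinj : Function.Injective p := by
    intro b c hbc
    have h := hinj (hbc ▸ hp c : p b ∈ openCell n c)
    simpa using h
  exact Set.finite_range_iff hpinj |>.1 hfin

variable {C}

lemma cellClosure_eq {n : ℕ} [Finite (cell C n)] (E : Set (cell C n)) :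
    cellClosure C E = ⋃ a ∈ E, closedCell n a := by
  rw [cellClosure, E.toFinite.closure_biUnion]
  simp only [CWComplex.closure_openCell_eq_closedCell]

/-- The `n`-cells contained in the closure of a set `E` of `n`-cells are those of `E`. -/
lemma mem_of_openCell_subset_cellClosure {n : ℕ} [Finite (cell C n)] {E : Set (cell C n)}
    {b : cell C n} (h : openCell n b ⊆ cellClosure C E) : b ∈ E := by
  -- The centre of `b` lies in some closed cell of `E`. It cannot lie on the frontier, which is in
  -- the lower skeleton, and distinct open cells are disjoint.
  have hy := CWComplex.map_zero_mem_openCell n b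
  set y := map (C := C) n b 0
  have hyE := h hy
  rw [cellClosure_eq] at hyE
  simp only [mem_iUnion, exists_prop] at hyE
  obtain ⟨a, ha, hya⟩ := hyE
  rw [← CWComplex.cellFrontier_union_openCell_eq_closedCell] at hya
  rcases hya with hya | hya
  · exact absurd hy (Set.disjoint_left.1 (skel_disjoint_openCell n b)
      (cellFrontier_subset_skel n a hya))
  · have := CWComplex.eq_of_not_disjoint_openCell (Set.not_disjoint_iff.2 ⟨y, hya, hy⟩)
    simp only [Sigma.mk.injEq, heq_eq_eq, true_and] at this
    exact this ▸ ha

/-! ### Support and cycle properties of the cellular boundary -/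

variable (F : Type u) [Field F]

variable (C) in
/-- The classes of the `k`-cells form a basis of the group of cellular `k`-chains. -/
def HasCellBasis (k : ℕ) : Prop :=
  LinearIndependent F (cellClass F (C := C) k) ∧
    ⊤ ≤ Submodule.span F (Set.range (cellClass F (C := C) k))

lemma cellCoord_of_not_hasCellBasis {k : ℕ} (h : ¬ HasCellBasis C F k) : cellCoord C F k = 0 :=
  dif_neg h

lemma linearCombination_cellCoord {k : ℕ} (h : HasCellBasis C F k) (x : cellularGroup C F k) :
    Finsupp.linearCombination F (cellClass F (C := C) k) (cellCoord C F k x) = x := by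
  have hc : cellCoord C F k = (Module.Basis.mk h.1 h.2).repr.toLinearMap := dif_pos h
  rw [hc]
  conv_rhs => rw [← (Module.Basis.mk h.1 h.2).linearCombination_repr x]
  rw [Module.Basis.coe_mk]
  rfl

/-- Basis vectors are nonzero, so the default value 0 of `orientation` cannot have been taken. -/
lemma HasCellBasis.isOrientation {k : ℕ} (h : HasCellBasis C F k) (b : cell C k) :
    IsOrientation F k b (orientation F k b) := by
  by_cases hex : ∃ g, IsOrientation F k b g
  · rw [orientation, dif_pos hex]
    exact hex.choose_spec
  · refine absurd ?_ (h.1.ne_zero b)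
    rw [cellClass, orientation, dif_neg hex, map_zero]

lemma IsOrientation.isLocallyNonzero {k : ℕ} {b : cell C k}
    {g : relHomology F k (cellFrontier_subset_closedCell k b)} (h : IsOrientation F k b g) :
    IsLocallyNonzero F k b g := by
  cases k with
  | zero => exact h.1
  | succ k => exact h

/-- The coordinate at a cell `b` of a cellular chain vanishes if the chain vanishes in the local
homology at some point of the open cell. -/
lemma cellCoord_apply_eq_zero {k : ℕ} {b : cell C k} {y : X} (hy : y ∈ openCell k b)
    (x : cellularGroup C F k) (hsk : skel C k ⊆ skel C (k + 1) \ {y})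
    (hx : relHomologyMap F k (skel_mono C k) (sdiff_subset : skel C (k + 1) \ {y} ⊆ _) hsk
      subset_rfl x = 0) : cellCoord C F k x b = 0 := by
  by_cases h : HasCellBasis C F k
  swap
  · rw [cellCoord_of_not_hasCellBasis F h]; rfl
  -- Expand `x` in cells and pass to local homology at `y`. The other closed `k`-cells miss `y` and
  -- contribute 0, leaving the coefficient of `b` times a nonzero class.
  rw [← linearCombination_cellCoord F h x, Finsupp.linearCombination_apply, Finsupp.sum,
    map_sum, Finset.sum_eq_single b] at hx
  · rw [map_smul, cellClass, relHomologyMap_relHomologyMap] at hx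
    exact (smul_eq_zero.1 hx).resolve_right ((h.isOrientation F b).isLocallyNonzero F y hy)
  · intro c _ hcb
    rw [map_smul, cellClass, relHomologyMap_relHomologyMap, relHomologyMap_eq_zero,
      LinearMap.zero_apply, smul_zero]
    refine fun z hz ↦ ⟨closedCell_subset_skel k c hz, ?_⟩
    rintro rfl
    rw [← CWComplex.cellFrontier_union_openCell_eq_closedCell] at hz
    rcases hz with hz | hz
    · exact Set.disjoint_left.1 (skel_disjoint_openCell k b) (cellFrontier_subset_skel k c hz) hy
    · have := CWComplex.eq_of_not_disjoint_openCell (Set.not_disjoint_iff.2 ⟨z, hz, hy⟩)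
      simp only [Sigma.mk.injEq, heq_eq_eq, true_and] at this
      exact hcb this
  · intro hb
    rw [Finsupp.notMem_support_iff.1 hb, zero_smul, map_zero]

lemma cellBoundary_single {k : ℕ} (a : cell C (k + 1)) :
    cellBoundary C F k (Finsupp.single a 1) =
      cellCoord C F k (cellularGroupBoundary C F k (cellClass F (k + 1) a)) := by
  simp [cellBoundary]

/-- The boundary of a cell is supported on the cells contained in its closure. -/
lemma cellBoundary_single_apply_eq_zero {k : ℕ} (a : cell C (k + 1)) (b : cell C k)
    (h : ¬ openCell k b ⊆ closedCell (k + 1) a) :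
    cellBoundary C F k (Finsupp.single a 1) b = 0 := by
  obtain ⟨y, hy, hya⟩ := Set.not_subset.1 h
  have hsk : skel C k ⊆ skel C (k + 1) \ {y} := fun x hx ↦
    ⟨skel_mono C k hx, fun hxy ↦ Set.disjoint_left.1 (skel_disjoint_openCell k b) hx (hxy ▸ hy)⟩
  have hfr : cellFrontier (k + 1) a ⊆ skel C (k + 1) \ {y} := fun x hx ↦
    ⟨cellFrontier_subset_skel (k + 1) a hx,
      fun hxy ↦ hya (hxy ▸ CWComplex.cellFrontier_subset_closedCell (k + 1) a hx)⟩
  rw [cellBoundary_single]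
  refine cellCoord_apply_eq_zero F hy _ hsk ?_
  -- By naturality the boundary of `a` comes from the homology of its frontier, which misses `y`, so
  -- it vanishes locally at `y`.
  rw [cellClass, cellularGroupBoundary,
    ← relHomologyMap_tripleBoundary F k (empty_subset (cellFrontier (k + 1) a))
      (cellFrontier_subset_closedCell (k + 1) a) (skel_mono C k) (skel_mono C (k + 1))
      (empty_subset _), relHomologyMap_relHomologyMap, relHomologyMap_eq_zero]
  · rfl
  · exact hfr

/-- The cellular boundary operators form a complex. -/
lemma cellBoundary_cellBoundary (k : ℕ) (x : cell C (k + 2) →₀ F) :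
    cellBoundary C F k (cellBoundary C F (k + 1) x) = 0 := by
  -- With a basis in the middle degree, taking coordinates and recombining is the identity; without
  -- one, the inner boundary is already 0.
  by_cases h : HasCellBasis C F (k + 1)
  · rw [cellBoundary, cellBoundary, LinearMap.comp_apply, LinearMap.comp_apply,
      LinearMap.comp_apply, linearCombination_cellCoord F h, LinearMap.comp_apply,
      cellularGroupBoundary, cellularGroupBoundary, tripleBoundary_tripleBoundary, map_zero]
  · rw [cellBoundary.eq_1 C F (k + 1), cellCoord_of_not_hasCellBasis F h, LinearMap.zero_comp,
      LinearMap.zero_apply, map_zero]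

lemma skel_zero_eq_empty : skel C 0 = ∅ := by
  simpa [skel] using CWComplex.skeletonLT_zero_eq_empty (C := C)

/-- The augmentation of the cellular boundary of a 1-chain vanishes. -/
lemma augmentation_cellBoundary (x : cell C 1 →₀ F) :
    augmentation C F (cellBoundary C F 0 x) = 0 := by
  by_cases h : HasCellBasis C F 0
  swap
  · rw [cellBoundary, cellCoord_of_not_hasCellBasis F h, LinearMap.zero_comp,
      LinearMap.zero_apply, map_zero]
  obtain ⟨ε, hε⟩ := exists_augmentation_of_eq_empty F (skel_mono C 0) skel_zero_eq_empty
  -- The normalization of `IsOrientation` in degree 0 enters here: without it, `ε` could take a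
  -- different nonzero value on each vertex.
  have hcell : ∀ b : cell C 0, ε (cellClass F 0 b) = 1 := by
    intro b
    obtain ⟨-, z, hz, hz1⟩ := h.isOrientation F b
    have hnat : HomologicalComplex.homologyMap
          (relProj F (cellFrontier_subset_closedCell 0 b)) 0 ≫
        HomologicalComplex.homologyMap (relChainsMap F (cellFrontier_subset_closedCell 0 b)
          (skel_mono C 0) (cellFrontier_subset_skel 0 b) (closedCell_subset_skel 0 b)) 0 =
        HomologicalComplex.homologyMap (chainsMap F (closedCell_subset_skel 0 b)) 0 ≫
          HomologicalComplex.homologyMap (relProj F (skel_mono C 0)) 0 := by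
      rw [← HomologicalComplex.homologyMap_comp, relProj_relChainsMap,
        HomologicalComplex.homologyMap_comp]
    have hcl : cellClass F 0 b = (HomologicalComplex.homologyMap (relProj F (skel_mono C 0)) 0).hom
        ((HomologicalComplex.homologyMap (chainsMap F (closedCell_subset_skel 0 b)) 0).hom z) := by
      rw [cellClass, ← hz]
      exact congrArg (fun f ↦ f.hom z) hnat
    rw [hcl, hε, singularAugmentation_homologyMap, hz1]
  have haug : ∀ c : cell C 0 →₀ F, augmentation C F c =
      ε (Finsupp.linearCombination F (cellClass F (C := C) 0) c) := by
    intro c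
    rw [augmentation, Finsupp.linearCombination_apply, Finsupp.linearCombination_apply,
      map_finsuppSum]
    simp only [map_smul, hcell]
  rw [haug, cellBoundary, LinearMap.comp_apply, linearCombination_cellCoord F h,
    LinearMap.comp_apply]
  generalize Finsupp.linearCombination F (cellClass F (C := C) 1) x = w
  -- The connecting map lands in classes of `H_0(X^0)` that die in `H_0(X^1)` (`skel C 2` is `X^1`),
  -- and the augmentation factors through the latter.
  have hδ := congrArg (fun f ↦ f.hom w) (connecting_comp_homologyMap F 0 (skel_mono C 1))
  have hε' := hε ((connecting F 0 (skel_mono C 1)).hom w)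
  refine hε'.trans ?_
  rw [← singularAugmentation_homologyMap F (skel_mono C 1)]
  refine (congrArg (singularAugmentation F (skel C 2)) hδ).trans ?_
  exact map_zero _

lemma cellBoundary_mem_reducedCycles {Y : Set X} {n : ℕ} (x : cell C (n + 1) →₀ F)
    (h : cellBoundary C F n x ∈ chainsIn C F Y n) :
    cellBoundary C F n x ∈ reducedCycles C F Y n := by
  cases n with
  | zero => exact ⟨h, augmentation_cellBoundary F x⟩
  | succ n => exact ⟨h, cellBoundary_cellBoundary F n x⟩

lemma chainsIn_inter (Y Z : Set X) (k : ℕ) :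
    chainsIn C F Y k ⊓ chainsIn C F Z k = chainsIn C F (Y ∩ Z) k := by
  rw [chainsIn, chainsIn, ← Finsupp.supported_inter]
  congr 1
  ext b
  exact subset_inter_iff.symm

/-! ### Rank and nullity for sets of top-dimensional cells -/

section Top

variable {n : ℕ} [Finite (cell C (n + 1))]

lemma cellsIn_cellClosure (E : Set (cell C (n + 1))) :
    cellsIn C (cellClosure C E) (n + 1) = E := by
  refine Subset.antisymm (fun b hb ↦ mem_of_openCell_subset_cellClosure hb) fun a ha ↦ ?_
  exact (subset_biUnion_of_mem (u := fun a : cell C (n + 1) ↦ openCell (n + 1) a) ha).trans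
    subset_closure

/-- The boundaries of the closure of a set of top-dimensional cells are spanned by the
corresponding columns of the boundary operator. -/
lemma boundaries_cellClosure (E : Set (cell C (n + 1))) :
    boundaries C F (cellClosure C E) n =
      Submodule.span F ((fun a ↦ cellBoundary C F n (Finsupp.single a 1)) '' E) := by
  rw [boundaries, chainsIn, cellsIn_cellClosure, Finsupp.supported_eq_span_single,
    Submodule.map_span, image_image]

lemma boundaries_cellClosure_le (E : Set (cell C (n + 1))) :
    boundaries C F (cellClosure C E) n ≤ chainsIn C F (cellClosure C E) n := by
  rw [boundaries_cellClosure, Submodule.span_le]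
  rintro _ ⟨a, ha, rfl⟩
  refine (Finsupp.mem_supported' F _).2 fun b hb ↦ ?_
  refine cellBoundary_single_apply_eq_zero F a b fun hab ↦ hb (hab.trans ?_)
  rw [cellClosure_eq]
  exact subset_biUnion_of_mem (u := fun a : cell C (n + 1) ↦ closedCell (n + 1) a) ha

/-- The nullity `η` is the dimension of the intersection of the spans of the two sets of columns of
the boundary operator. -/
lemma eta_eq_finrank_inf {E₁ E₂ : Set (cell C (n + 1))} (hE : Disjoint E₁ E₂) :
    eta C F n E₁ E₂ = Module.finrank F
      (boundaries C F (cellClosure C E₁) n ⊓ boundaries C F (cellClosure C E₂) n :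
        Submodule F (cell C n →₀ F)) := by
  refine Subquotient.finrank_ker_map_prod_map _ _ _ _ ?_ ?_
  -- Disjoint sets of top cells share no cell, so the intersection of the closures has no
  -- boundaries.
  · rw [boundaries, ← chainsIn_inter, chainsIn, chainsIn, cellsIn_cellClosure,
      cellsIn_cellClosure, ← Finsupp.supported_inter, hE.inter_eq, Finsupp.supported_empty,
      Submodule.map_bot]
  · intro z hz
    have hzc : z ∈ chainsIn C F (cellClosure C E₁ ∩ cellClosure C E₂) n := by
      rw [← chainsIn_inter]
      exact ⟨boundaries_cellClosure_le F E₁ hz.1, boundaries_cellClosure_le F E₂ hz.2⟩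
    obtain ⟨x, -, rfl⟩ := hz.1
    exact cellBoundary_mem_reducedCycles F x hzc

/-- The rank in the cellular matroid is the dimension of the space of boundaries of the closure. -/
lemma cellularMatroid_eRk (E : Set (cell C (n + 1))) :
    (cellularMatroid C F n).eRk E =
      (Module.finrank F (boundaries C F (cellClosure C E) n) : ℕ∞) := by
  rw [cellularMatroid, linearMatroid_eRk, boundaries_cellClosure]

/-- The connectivity `r(E₁) + r(E₂) - r(M)` of a partition of the top-dimensional cells is the
nullity `η`. -/
lemma eRk_add_eRk_eq {E₁ E₂ : Set (cell C (n + 1))} (hU : E₁ ∪ E₂ = univ)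
    (hE : Disjoint E₁ E₂) :
    (cellularMatroid C F n).eRk E₁ + (cellularMatroid C F n).eRk E₂ =
      (cellularMatroid C F n).eRank + eta C F n E₁ E₂ := by
  have hfin (E : Set (cell C (n + 1))) :
      FiniteDimensional F (boundaries C F (cellClosure C E) n) := by
    rw [boundaries_cellClosure]
    exact FiniteDimensional.span_of_finite F (E.toFinite.image _)
  have := hfin E₁
  have := hfin E₂
  -- The two sets of columns together span the whole column space, whose dimension is the rank of
  -- the matroid.
  have hsup : boundaries C F (cellClosure C E₁) n ⊔ boundaries C F (cellClosure C E₂) n =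
      boundaries C F (cellClosure C (univ : Set (cell C (n + 1)))) n := by
    simp only [boundaries_cellClosure]
    rw [← Submodule.span_union, ← image_union, hU]
  have hdim := Submodule.finrank_sup_add_finrank_inf_eq
    (boundaries C F (cellClosure C E₁) n) (boundaries C F (cellClosure C E₂) n)
  rw [hsup, ← eta_eq_finrank_inf F hE] at hdim
  rw [← Matroid.eRk_ground, cellularMatroid_eRk, cellularMatroid_eRk, cellularMatroid,
    linearMatroid_ground, ← cellularMatroid, cellularMatroid_eRk]
  exact_mod_cast hdim.symm

end Top

end Cellular

end CellularMatroid

/-! ### The connectivity criterion -/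

theorem mainTheorem2 {F X : Type u} [Field F] [TopologicalSpace X] [T2Space X]
    (C : Set X) [Topology.CWComplex C] (n : ℕ) (hreg : CellularMatroid.IsRegular C)
    (hdim : CellularMatroid.IsPureDimensional C (n + 1)) (k : ℕ) :
    CellularMatroid.IsKConnected (CellularMatroid.cellularMatroid C F n) k ↔
      ∀ l : ℕ, 1 ≤ l → l < k → ∀ E₁ E₂ : Set (Topology.RelCWComplex.cell C (n + 1)),
        E₁ ∪ E₂ = Set.univ → Disjoint E₁ E₂ → (l : ℕ∞) ≤ E₁.encard → (l : ℕ∞) ≤ E₂.encard →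
          l ≤ CellularMatroid.eta C F n E₁ E₂ := by
  have := CellularMatroid.finite_cell_of_isCompact C hreg.isCompact (n + 1)
  have hfin : (CellularMatroid.cellularMatroid C F n).eRank ≠ ⊤ := by
    rw [← Matroid.eRk_ground, CellularMatroid.cellularMatroid_eRk]
    exact ENat.natCast_ne_top _
  -- The rank inequality becomes `η + 1 ≤ l` once the rank of the matroid is cancelled; in `ℕ∞` this
  -- requires the rank to be finite.
  have hrank (l : ℕ) {E₁ E₂ : Set (Topology.RelCWComplex.cell C (n + 1))}
      (hU : E₁ ∪ E₂ = Set.univ) (hE : Disjoint E₁ E₂) :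
      (CellularMatroid.cellularMatroid C F n).eRk E₁ +
          (CellularMatroid.cellularMatroid C F n).eRk E₂ + 1 ≤
        (CellularMatroid.cellularMatroid C F n).eRank + l ↔
          ¬ l ≤ CellularMatroid.eta C F n E₁ E₂ := by
    rw [CellularMatroid.eRk_add_eRk_eq F hU hE, add_assoc, ENat.add_le_add_iff_left hfin, not_le,
      ← Nat.succ_le_iff]
    exact_mod_cast Iff.rfl
  refine forall_congr' fun l ↦ forall₂_congr fun _ _ ↦ forall₂_congr fun E₁ E₂ ↦ ?_
  constructor
  · intro h hU hE h₁ h₂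
    by_contra hl
    exact h ⟨hU, hE, h₁, h₂, (hrank l hU hE).2 hl⟩
  · rintro h ⟨hU, hE, h₁, h₂, hr⟩
    exact (hrank l hU hE).1 hr (h hU hE h₁ h₂)
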